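/- Let $r\ge 0$ and let $X\subset\mathbb R^r$ be a compact nonsingular real algebraic variety: $X$ is compact, is the zero set of a family of polynomials, and for every $x\in X$ there are polynomials $P_1,\dots,P_c$ vanishing on all of $X$ and an open neighborhood $W$ of $x$ in $\mathbb R^r$ such that $X\cap W=\{P_1=\dots=P_c=0\}\cap W$ and the differentials $d_xP_1,\dots,d_xP_c$ are linearly independent. (Neither irreducibility nor pure dimension is assumed.) A map between subsets of Euclidean spaces is called Nash if it is real analytic (near each point of its domain it is the restriction of an analytic map on an open set of the ambient space) and its graph is semialgebraic; a Nash isomorphism is a bijective Nash map whose inverse is Nash. Then $X$ admits a submersive Nash deformation of the identity, that is, there are $l\in\mathbb N$, a semialgebraic open neighborhood $U$ of the origin in $\mathbb R^l$, and a Nash map $\Theta:U\times X\to X$ such that, with $\Theta_t(x)=\Theta^x(t)=\Theta(t,x)$: 1. $\Theta_t:X\to X$ is a Nash isomorphism for all $t\in U$; 2. $\Theta_0(x)=x$ for all $x\in X$; 3. for all $x\in X$ and all $t\in U$ the differential of $\Theta^x:U\to X$ at $t$ maps $\mathbb R^l$ onto the tangent space $T_{\Theta(t,x)}X$ of $X$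 at $\Theta(t,x)$. -/

import Mathlib

open MvPolynomial

noncomputable section

/-- The differential of the polynomial `p` at the point `y` of `ℝ ^ σ`, as a linear form. -/
def polyDifferential {σ : Type*} [Fintype σ] (p : MvPolynomial σ ℝ) (y : σ → ℝ) :
    (σ → ℝ) →ₗ[ℝ] ℝ :=
  ∑ i, eval y (pderiv i p) • LinearMap.proj i

/-- `X` is a real algebraic subset of `ℝ ^ σ`: the zero set of an ideal of polynomials. -/
def IsRealAlgebraicSet {σ : Type*} (X : Set (σ → ℝ)) : Prop :=
  ∃ I : Ideal (MvPolynomial σ ℝ), X = zeroLocus ℝ I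

/-- The point `x` of the real algebraic set `X` is nonsingular (of dimension `card σ - c` for some
`c`): near `x` the set `X` is cut out by `c` polynomials that vanish on all of `X` and whose
differentials at `x` are linearly independent. -/
def IsNonsingularAt {σ : Type*} [Fintype σ] (X : Set (σ → ℝ)) (x : σ → ℝ) : Prop :=
  ∃ (c : ℕ) (P : Fin c → MvPolynomial σ ℝ) (W : Set (σ → ℝ)),
    (∀ j, P j ∈ vanishingIdeal ℝ X) ∧
    IsOpen W ∧ x ∈ W ∧
    X ∩ W = {y | ∀ j, eval y (P j) = 0} ∩ W ∧
    LinearIndependent ℝ (fun j => polyDifferential (P j) x)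

/-- `X` is a nonsingular real algebraic subvariety of `ℝ ^ σ`. It may be reducible, and its
connected components may have different dimensions. -/
structure IsNonsingularVariety {σ : Type*} [Fintype σ] (X : Set (σ → ℝ)) : Prop where
  algebraic : IsRealAlgebraicSet X
  nonsingular : ∀ x ∈ X, IsNonsingularAt X x

/-- The tangent space of `X` at `y`: the vectors killed by the differentials at `y` of all
polynomials that vanish on `X`. -/
def varietyTangentSpace {σ : Type*} [Fintype σ] (X : Set (σ → ℝ)) (y : σ → ℝ) :
    Submodule ℝ (σ → ℝ) :=
  ⨅ p ∈ vanishingIdeal ℝ X, LinearMap.ker (polyDifferential p y)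

/-- The semialgebraic subsets of `ℝ ^ σ`: the smallest family of subsets that contains the sets
`{x | 0 < p x}`, `p` a polynomial, and is closed under finite unions, finite intersections and
complements. -/
inductive IsSemialgebraic {σ : Type*} : Set (σ → ℝ) → Prop
  | pos (p : MvPolynomial σ ℝ) : IsSemialgebraic {x | 0 < eval x p}
  | union {A B : Set (σ → ℝ)} : IsSemialgebraic A → IsSemialgebraic B → IsSemialgebraic (A ∪ B)
  | inter {A B : Set (σ → ℝ)} : IsSemialgebraic A → IsSemialgebraic B → IsSemialgebraic (A ∩ B)
  | compl {A : Set (σ → ℝ)} : IsSemialgebraic A → IsSemialgebraic Aᶜ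

/-- The product of `A ⊆ ℝ ^ σ` and `B ⊆ ℝ ^ τ`, as a subset of `ℝ ^ (σ ⊕ τ)`. -/
def coordProd {σ τ : Type*} (A : Set (σ → ℝ)) (B : Set (τ → ℝ)) : Set (σ ⊕ τ → ℝ) :=
  {z | z ∘ Sum.inl ∈ A ∧ z ∘ Sum.inr ∈ B}

/-- The graph of the map `f` with domain `A ⊆ ℝ ^ σ`, as a subset of `ℝ ^ (σ ⊕ τ)`. -/
def graphOver {σ τ : Type*} (A : Set (σ → ℝ)) (f : (σ → ℝ) → (τ → ℝ)) : Set (σ ⊕ τ → ℝ) :=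
  {z | z ∘ Sum.inl ∈ A ∧ z ∘ Sum.inr = f (z ∘ Sum.inl)}

/-- `f` restricts to a Nash map `A → B`: it is real analytic on `A` (near each point of `A` it
agrees on `A` with a convergent power series in the ambient coordinates) and its graph is
semialgebraic. The values of `f` outside `A` play no role. -/
structure IsNashMap {σ τ : Type*} [Fintype σ] [Fintype τ] (A : Set (σ → ℝ)) (B : Set (τ → ℝ))
    (f : (σ → ℝ) → (τ → ℝ)) : Prop where
  mapsTo : Set.MapsTo f A B
  analyticOn : AnalyticOn ℝ f A
  semialgebraic_graph : IsSemialgebraic (graphOver A f)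

/-- `f` restricts to a Nash isomorphism `A → B`: a Nash map with a Nash inverse. -/
def IsNashIso {σ τ : Type*} [Fintype σ] [Fintype τ] (A : Set (σ → ℝ)) (B : Set (τ → ℝ))
    (f : (σ → ℝ) → (τ → ℝ)) : Prop :=
  IsNashMap A B f ∧ ∃ g : (τ → ℝ) → (σ → ℝ), IsNashMap B A g ∧ Set.InvOn g f A B

/-- `Θ` is a submersive Nash deformation of the identity of `X`, with parameters in the
semialgebraic open neighbourhood `U` of the origin of `ℝ ^ l`. -/
structure IsSubmersiveNashDeformation {σ : Type*} [Fintype σ] {l : ℕ} (X : Set (σ → ℝ))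
    (U : Set (Fin l → ℝ)) (Θ : (Fin l → ℝ) → (σ → ℝ) → (σ → ℝ)) : Prop where
  isOpen : IsOpen U
  zero_mem : (0 : Fin l → ℝ) ∈ U
  semialgebraic : IsSemialgebraic U
  /-- `Θ : U × X → X` is a Nash map. -/
  nash : IsNashMap (coordProd U X) X (fun z => Θ (z ∘ Sum.inl) (z ∘ Sum.inr))
  nashIso : ∀ t ∈ U, IsNashIso X X (Θ t)
  map_zero : ∀ x ∈ X, Θ 0 x = x
  /-- The differential at `t` of `t ↦ Θ t x` maps onto the tangent space of `X` at `Θ t x`. -/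
  submersive : ∀ x ∈ X, ∀ t ∈ U,
    DifferentiableAt ℝ (fun s => Θ s x) t ∧
    LinearMap.range (fderiv ℝ (fun s => Θ s x) t : (Fin l → ℝ) →ₗ[ℝ] (σ → ℝ)) =
      varietyTangentSpace X (Θ t x)

end

/-! Take `l = r`, translate by `t`, and project back: `Θ t x` is the foot near `x` of a normal of
`X` through `x + t`. Locally `Θ t x = φ (x + t)`, where `φ` is the analytic retraction of a tubular
neighbourhood along the normal spaces. The differential of `φ` maps onto the tangent space, so
already `t ↦ Θ t x` is a submersion onto `X`. The inverse of `Θ t` sends `y` to the point `x` of `X`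
near `y` with `x + t - y` normal at `y`, that is, to a point of `X ∩ (y - t + N_y)`.

Both maps come from one analytic implicit function statement, `exists_analyticAt_normalSolution`:
the normal directions are taken at the unknown point for `φ`, and at a prescribed point for the
inverse. Its local existence and uniqueness statements become uniform for small `t` by compactness
of `X`.

Semialgebraicity needs no quantifier elimination. The graph of `Θ` is cut out by membership in `X`,
a distance bound and membership in the normal bundle. Over each set of a finite cover, the normal
bundle is given by polynomial equations (`IsNonsingularVariety.isSemialgebraic_normalBundle`). -/

open scoped Topology

/-! ### Analytic inverse and implicit functions -/

/-- A self-map of a finite-dimensional space that is analytic at a point with injective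
differential there has an analytic local inverse. -/
theorem exists_analyticAt_localInverse {E : Type*} [NormedAddCommGroup E] [NormedSpace ℝ E]
    [FiniteDimensional ℝ E] {f : E → E} {a : E} (hf : AnalyticAt ℝ f a)
    (hinj : ∀ h, fderiv ℝ f a h = 0 → h = 0) :
    ∃ g : E → E, AnalyticAt ℝ g (f a) ∧ g (f a) = a ∧
      (∀ᶠ x in 𝓝 a, g (f x) = x) ∧ ∀ᶠ y in 𝓝 (f a), f (g y) = y := by
  have := FiniteDimensional.complete ℝ E
  have hinj' : Function.Injective (fderiv ℝ f a : E →ₗ[ℝ] E) :=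
    (injective_iff_map_eq_zero _).2 hinj
  let i : E ≃L[ℝ] E := (LinearEquiv.ofInjectiveEndo _ hinj').toContinuousLinearEquiv
  have hi : (i : E →L[ℝ] E) = fderiv ℝ f a := by ext; rfl
  have hfd : HasStrictFDerivAt f (i : E →L[ℝ] E) a := by rw [hi]; exact hf.hasStrictFDerivAt
  let R := hfd.toOpenPartialHomeomorph f
  have ha : a ∈ R.source := hfd.mem_toOpenPartialHomeomorph_source
  refine ⟨R.symm, ?_, R.left_inv ha, R.eventually_left_inverse ha,
    R.eventually_right_inverse (R.map_source ha)⟩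
  exact R.analyticAt_symm' ha hf hi.symm

/-- Solving `f x = 0` together with `z - x ∈ range (B (w, x))` for `x`, when the differential of
`f` and the range of `B` are complementary: the solution `φ (w, z)` is analytic in `(w, z)`, its
differential in `z` maps onto the kernel of the differential of `f`, and it is locally unique. -/
theorem exists_analyticAt_normalSolution {W V Λ : Type*}
    [NormedAddCommGroup W] [NormedSpace ℝ W] [FiniteDimensional ℝ W]
    [NormedAddCommGroup V] [NormedSpace ℝ V] [FiniteDimensional ℝ V]
    [NormedAddCommGroup Λ] [NormedSpace ℝ Λ] [FiniteDimensional ℝ Λ]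
    {f : V → Λ} {B : W × V → (Λ →L[ℝ] V)} {w₀ : W} {x₀ : V}
    (hf : AnalyticAt ℝ f x₀) (hB : AnalyticAt ℝ B (w₀, x₀)) (hfx : f x₀ = 0)
    (htrans : ∀ μ, fderiv ℝ f x₀ (B (w₀, x₀) μ) = 0 → μ = 0) :
    ∃ φ : W × V → V, AnalyticAt ℝ φ (w₀, x₀) ∧ φ (w₀, x₀) = x₀ ∧
      (∀ᶠ q in 𝓝 (w₀, x₀), f (φ q) = 0 ∧ (∃ μ, q.2 = φ q + B (q.1, φ q) μ) ∧
        ∀ v, fderiv ℝ f (φ q) v = 0 → ∃ k, fderiv ℝ φ q (0, k) = v) ∧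
      ∀ᶠ p : W × V × V in 𝓝 (w₀, x₀, x₀), f p.2.2 = 0 →
        (∃ μ, p.2.1 = p.2.2 + B (p.1, p.2.2) μ) → p.2.2 = φ (p.1, p.2.1) := by
  -- Carrying the parameter and the multiplier along makes the system square. At `p₀` the multiplier
  -- is `0`, so the derivative of `B` drops out of the differential of `F`, and `htrans` gives
  -- injectivity. The solution is then the middle component of the inverse of `F` at `(w, z, 0)`.
  let F : W × V × Λ → W × V × Λ := fun p => (p.1, p.2.1 + B (p.1, p.2.1) p.2.2, f p.2.1)
  let p₀ : W × V × Λ := (w₀, x₀, 0)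
  have hFp : F p₀ = p₀ := by simp [F, p₀, hfx]
  have hx : AnalyticAt ℝ (fun p : W × V × Λ => p.2.1) p₀ :=
    analyticAt_fst.fun_comp analyticAt_snd
  have hwx : AnalyticAt ℝ (fun p : W × V × Λ => (p.1, p.2.1)) p₀ :=
    analyticAt_fst.prod hx
  have hl : AnalyticAt ℝ (fun p : W × V × Λ => p.2.2) p₀ :=
    analyticAt_snd.fun_comp analyticAt_snd
  have hBp : AnalyticAt ℝ (fun p : W × V × Λ => B (p.1, p.2.1)) p₀ :=
    AnalyticAt.fun_comp (g := B) hB hwx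
  have hfp : AnalyticAt ℝ (fun p : W × V × Λ => f p.2.1) p₀ := AnalyticAt.fun_comp (g := f) hf hx
  have hFa : AnalyticAt ℝ F p₀ := by
    refine AnalyticAt.prod analyticAt_fst (AnalyticAt.prod (hx.add ?_) hfp)
    exact ((ContinuousLinearMap.apply ℝ V).flip.analyticAt_bilinear _).comp₂ hBp hl
  have hder : ∀ h, fderiv ℝ F p₀ h = (h.1, h.2.1 + B (w₀, x₀) h.2.2, fderiv ℝ f x₀ h.2.1) := by
    intro h
    have d1 : HasFDerivAt (fun p : W × V × Λ => p.2.1)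
        ((ContinuousLinearMap.fst ℝ V Λ).comp (ContinuousLinearMap.snd ℝ W (V × Λ))) p₀ :=
      hasFDerivAt_fst.comp p₀ hasFDerivAt_snd
    have d2 : HasFDerivAt (fun p : W × V × Λ => p.2.2)
        ((ContinuousLinearMap.snd ℝ V Λ).comp (ContinuousLinearMap.snd ℝ W (V × Λ))) p₀ :=
      hasFDerivAt_snd.comp p₀ hasFDerivAt_snd
    have d3 := (hasFDerivAt_fst (𝕜 := ℝ) (p := p₀)).prodMk
      ((d1.add (hBp.differentiableAt.hasFDerivAt.clm_apply d2)).prodMk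
        (hf.differentiableAt.hasFDerivAt.comp p₀ d1))
    rw [HasFDerivAt.fderiv (f := F) d3]
    simp [p₀]
  have hinj : ∀ h, fderiv ℝ F p₀ h = 0 → h = 0 := by
    rintro ⟨h1, h2, h3⟩ hh
    rw [hder] at hh
    simp only [Prod.mk_eq_zero] at hh
    obtain ⟨e1, e2, e3⟩ := hh
    have e4 : h2 = - B (w₀, x₀) h3 := eq_neg_of_add_eq_zero_left e2
    have e5 : h3 = 0 := by
      apply htrans
      rw [e4] at e3
      simpa using e3
    simp [e1, e4, e5]
  obtain ⟨G, hGa, hGp, hGF, hFG⟩ := exists_analyticAt_localInverse hFa hinj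
  rw [hFp] at hGa hGp hFG
  let ι : W × V → W × V × Λ := fun q => (q.1, q.2, 0)
  have hι : ContinuousAt ι (w₀, x₀) := by fun_prop
  have hιa (q) : AnalyticAt ℝ ι q :=
    analyticAt_fst.prod (analyticAt_snd.prod analyticAt_const)
  have hGι : Filter.Tendsto (fun q => G (ι q)) (𝓝 (w₀, x₀)) (𝓝 p₀) := by
    have := hGa.continuousAt.comp_of_eq (f := ι) (x := (w₀, x₀)) hι rfl
    have h2 := this.tendsto
    simpa [ι, Function.comp_def, show G (w₀, x₀, 0) = p₀ from hGp] using h2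
  refine ⟨fun q => (G (ι q)).2.1, ?_, ?_, ?_, ?_⟩
  · have : AnalyticAt ℝ (fun q => G (ι q)) (w₀, x₀) := AnalyticAt.fun_comp (g := G) hGa (hιa _)
    exact AnalyticAt.fun_comp (g := fun p : W × V × Λ => p.2.1)
      (analyticAt_fst.fun_comp analyticAt_snd) this
  · change (G p₀).2.1 = x₀
    rw [hGp]
  · filter_upwards [hι.eventually hFG, hι.eventually hGa.eventually_analyticAt,
      hGι.eventually hGF.eventually_nhds, hGι.eventually hFa.eventually_analyticAt,
      hGι.eventually (hx.continuousAt.eventually hf.eventually_analyticAt)]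
      with q h1 h2 h3 h4 h5
    have e1 : (G (ι q)).1 = q.1 := congrArg Prod.fst h1
    have e2 : (G (ι q)).2.1 + B ((G (ι q)).1, (G (ι q)).2.1) (G (ι q)).2.2 = q.2 :=
      congrArg (fun p : W × V × Λ => p.2.1) h1
    have e3 : f (G (ι q)).2.1 = 0 := congrArg (fun p : W × V × Λ => p.2.2) h1
    refine ⟨e3, ⟨(G (ι q)).2.2, by rw [← e1, e2]⟩, fun v hv => ?_⟩
    -- If the differential of `f` kills `v`, then that of `F` sends `(0, v, 0)` to some `(0, k, 0)`.
    -- The differential of `G` sends this back to `(0, v, 0)`, so `k` is the required preimage of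
    -- `v`.
    have dF := h4.differentiableAt.hasFDerivAt
    have dG : HasFDerivAt G (fderiv ℝ G (ι q)) (ι q) := h2.differentiableAt.hasFDerivAt
    have dG' : HasFDerivAt G (fderiv ℝ G (ι q)) (F (G (ι q))) := by rw [h1]; exact dG
    have hcomp : (fderiv ℝ G (ι q)).comp (fderiv ℝ F (G (ι q))) = ContinuousLinearMap.id ℝ _ :=
      (dG'.comp _ dF).unique ((hasFDerivAt_id _).congr_of_eventuallyEq h3)
    have c1 : (fderiv ℝ F (G (ι q)) (0, v, 0)).1 = 0 := by
      have d0 : HasFDerivAt (fun p : W × V × Λ => (F p).1)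
          ((ContinuousLinearMap.fst ℝ W (V × Λ)).comp (fderiv ℝ F (G (ι q)))) (G (ι q)) := dF.fst
      have := d0.unique (hasFDerivAt_fst (𝕜 := ℝ) (p := G (ι q)))
      exact congrArg (fun L : W × V × Λ →L[ℝ] W => L (0, v, 0)) this
    have c2 : (fderiv ℝ F (G (ι q)) (0, v, 0)).2.2 = 0 := by
      have d1 : HasFDerivAt (fun p : W × V × Λ => p.2.1)
          ((ContinuousLinearMap.fst ℝ V Λ).comp (ContinuousLinearMap.snd ℝ W (V × Λ))) (G (ι q)) :=
        hasFDerivAt_fst.comp _ hasFDerivAt_snd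
      have d2 : HasFDerivAt (fun p : W × V × Λ => p.2.2)
          ((ContinuousLinearMap.snd ℝ V Λ).comp (ContinuousLinearMap.snd ℝ W (V × Λ)))
          (F (G (ι q))) := hasFDerivAt_snd.comp _ hasFDerivAt_snd
      have d3 : HasFDerivAt (fun p : W × V × Λ => f p.2.1) _ (G (ι q)) :=
        HasFDerivAt.comp (g := f) (G (ι q)) h5.differentiableAt.hasFDerivAt d1
      have := (d2.comp _ dF).unique d3
      have := congrArg (fun L : W × V × Λ →L[ℝ] Λ => L (0, v, 0)) this
      simp only [ContinuousLinearMap.comp_apply] at this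
      exact this.trans hv
    refine ⟨(fderiv ℝ F (G (ι q)) (0, v, 0)).2.1, ?_⟩
    have dι : HasFDerivAt ι ((ContinuousLinearMap.fst ℝ W V).prod
        ((ContinuousLinearMap.snd ℝ W V).prod 0)) q :=
      hasFDerivAt_fst.prodMk (hasFDerivAt_snd.prodMk (hasFDerivAt_const _ _))
    have d1 : HasFDerivAt (fun p : W × V × Λ => p.2.1)
        ((ContinuousLinearMap.fst ℝ V Λ).comp (ContinuousLinearMap.snd ℝ W (V × Λ))) (G (ι q)) :=
      hasFDerivAt_fst.comp _ hasFDerivAt_snd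
    have d3 := d1.comp q (dG.comp q dι)
    rw [HasFDerivAt.fderiv (f := fun q => (G (ι q)).2.1) d3]
    have e4 : ((0 : W), (fderiv ℝ F (G (ι q)) (0, v, 0)).2.1, (0 : Λ)) =
        fderiv ℝ F (G (ι q)) (0, v, 0) := by
      refine Prod.ext c1.symm (Prod.ext rfl c2.symm)
    have e5 := congrArg (fun L : W × V × Λ →L[ℝ] W × V × Λ => L (0, v, 0)) hcomp
    simp only [ContinuousLinearMap.comp_apply, ContinuousLinearMap.id_apply] at e5
    simp [e4, e5]
  -- The local inverse only recognises triples near `p₀`, so the multiplier `μ` must be shown to be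
  -- small. Transversality makes `B (w₀, x₀)` bounded below by `1 / K`; perturbing it by less than
  -- `1 / (2 * K)` costs at most half of `‖μ‖`, whence `‖μ‖ ≤ 2 * K * ‖z - x‖`.
  · obtain ⟨K, hK, hanti⟩ := LinearMap.exists_antilipschitzWith
      (B (w₀, x₀) : Λ →ₗ[ℝ] V) (by
        rw [LinearMap.ker_eq_bot']
        intro m hm
        apply htrans
        rw [show B (w₀, x₀) m = 0 from hm, map_zero])
    have hKpos : (0 : ℝ) < K := hK
    have hBc : Filter.Tendsto (fun p : W × V × V => B (p.1, p.2.2)) (𝓝 (w₀, x₀, x₀))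
        (𝓝 (B (w₀, x₀))) := by
      have : ContinuousAt (fun p : W × V × V => (p.1, p.2.2)) (w₀, x₀, x₀) := by fun_prop
      exact (hB.continuousAt.comp_of_eq this rfl).tendsto
    have hsmall : ∀ᶠ p : W × V × V in 𝓝 (w₀, x₀, x₀),
        ‖B (p.1, p.2.2) - B (w₀, x₀)‖ < 1 / (2 * K) := by
      have := hBc.eventually (Metric.ball_mem_nhds _ (show (0 : ℝ) < 1 / (2 * K) by positivity))
      simpa [dist_eq_norm] using this
    obtain ⟨ε, hε, hball⟩ := Metric.eventually_nhds_iff.1 hGF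
    have hd : Filter.Tendsto (fun p : W × V × V => 2 * K * ‖p.2.1 - p.2.2‖) (𝓝 (w₀, x₀, x₀))
        (𝓝 0) := by
      have : Continuous (fun p : W × V × V => 2 * (K : ℝ) * ‖p.2.1 - p.2.2‖) := by fun_prop
      simpa using this.tendsto (w₀, x₀, x₀)
    have hp1 : Filter.Tendsto (fun p : W × V × V => p.1) (𝓝 (w₀, x₀, x₀)) (𝓝 w₀) :=
      continuous_fst.tendsto _
    have hp2 : Filter.Tendsto (fun p : W × V × V => p.2.2) (𝓝 (w₀, x₀, x₀)) (𝓝 x₀) :=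
      (continuous_snd.comp continuous_snd).tendsto (w₀, x₀, x₀)
    filter_upwards [hsmall, hd.eventually (gt_mem_nhds hε),
      hp1.eventually (Metric.ball_mem_nhds _ hε), hp2.eventually (Metric.ball_mem_nhds _ hε)]
      with ⟨w, z, x⟩ h1 h2 h3 h4 hfx ⟨μ, hμ⟩
    simp only at h1 h2 h3 h4 hfx hμ
    have hn : ‖μ‖ ≤ 2 * K * ‖z - x‖ := by
      have a1 : ‖μ‖ ≤ K * ‖B (w₀, x₀) μ‖ := by
        have := hanti.le_mul_dist μ 0
        simpa [dist_eq_norm] using this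
      have a2 : B (w₀, x₀) μ = (z - x) - (B (w, x) - B (w₀, x₀)) μ := by
        simp [hμ]
      have a3 : ‖B (w₀, x₀) μ‖ ≤ ‖z - x‖ + 1 / (2 * K) * ‖μ‖ := by
        rw [a2]
        refine (norm_sub_le _ _).trans (add_le_add_right ?_ _)
        exact (ContinuousLinearMap.le_opNorm _ _).trans (by gcongr)
      have a4 : K * (1 / (2 * K) * ‖μ‖) = ‖μ‖ / 2 := by field_simp
      nlinarith [mul_le_mul_of_nonneg_left a3 hKpos.le]
    have hG := hball (y := (w, x, μ)) (by
      rw [Prod.dist_eq, Prod.dist_eq]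
      refine max_lt h3 (max_lt h4 ?_)
      simpa [p₀] using hn.trans_lt h2)
    have hFe : F (w, x, μ) = ι (w, z) := by simp [F, ι, hfx, hμ]
    rw [hFe] at hG
    simp [hG]

/-! ### Polynomial differentials and gradients -/

section Polynomials

variable {σ : Type*} [Fintype σ]

theorem polyDifferential_apply (p : MvPolynomial σ ℝ) (y v : σ → ℝ) :
    polyDifferential p y v = ∑ i, eval y (pderiv i p) * v i := by
  simp [polyDifferential]

theorem hasFDerivAt_eval (p : MvPolynomial σ ℝ) (y : σ → ℝ) :
    HasFDerivAt (fun x => eval x p) (polyDifferential p y).toContinuousLinearMap y := by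
  classical
  induction p using MvPolynomial.induction_on with
  | C a =>
    have h0 : (polyDifferential (C a) y).toContinuousLinearMap = 0 := by
      ext v; simp [polyDifferential_apply]
    rw [h0]
    simpa using hasFDerivAt_const a y
  | add p q hp hq =>
    convert! hp.add hq using 1
    · ext x; simp
    · ext v; simp [polyDifferential_apply, add_mul, Finset.sum_add_distrib]
  | mul_X p i hp =>
    convert! hp.mul (hasFDerivAt_apply i y) using 1
    · ext x; simp
    · ext v
      simp only [polyDifferential_apply, LinearMap.coe_toContinuousLinearMap',
        Derivation.leibniz, pderiv_X, smul_eq_mul, map_add, map_mul, eval_X, add_mul,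
        Finset.sum_add_distrib, add_apply, smul_apply,
        ContinuousLinearMap.proj_apply, Finset.mul_sum]
      congr 1
      · rw [Finset.sum_eq_single i]
        · simp
        · intro j _ hj; simp [hj.symm]
        · simp
      · exact Finset.sum_congr rfl fun j _ => by ring

theorem analyticAt_eval (p : MvPolynomial σ ℝ) (y : σ → ℝ) :
    AnalyticAt ℝ (fun x => eval x p) y :=
  AnalyticOnNhd.eval_mvPolynomial p y trivial

variable {c : ℕ} (P : Fin c → MvPolynomial σ ℝ)

/-- The transpose of the Jacobian matrix of `P` at `x`: it maps `μ` to the combination of the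
gradients of the `P j` with coefficients `μ j`. -/
noncomputable def gradientCombination (x : σ → ℝ) : (Fin c → ℝ) →L[ℝ] (σ → ℝ) :=
  ∑ j, ContinuousLinearMap.smulRightL ℝ _ _ (ContinuousLinearMap.proj j)
    (fun i => eval x (pderiv i (P j)))

theorem gradientCombination_apply (x : σ → ℝ) (μ : Fin c → ℝ) (i : σ) :
    gradientCombination P x μ i = ∑ j, μ j * eval x (pderiv i (P j)) := by
  simp [gradientCombination]

theorem analyticAt_gradientCombination (x : σ → ℝ) :
    AnalyticAt ℝ (gradientCombination P) x := by
  have : gradientCombination P = fun x => ∑ j, ContinuousLinearMap.smulRightL ℝ _ _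
      (ContinuousLinearMap.proj j) (fun i => eval x (pderiv i (P j))) := rfl
  rw [this]
  refine Finset.analyticAt_fun_sum _ fun j _ => ?_
  exact (ContinuousLinearMap.analyticAt _ _).fun_comp
    (AnalyticAt.pi fun i => analyticAt_eval _ _)

theorem dotProduct_gradientCombination (x v : σ → ℝ) (μ : Fin c → ℝ) :
    v ⬝ᵥ gradientCombination P x μ = ∑ j, μ j * polyDifferential (P j) x v := by
  simp only [dotProduct, gradientCombination_apply, polyDifferential_apply, Finset.mul_sum]
  rw [Finset.sum_comm]
  exact Finset.sum_congr rfl fun j _ => Finset.sum_congr rfl fun i _ => by ring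

theorem analyticAt_evalTuple (x : σ → ℝ) : AnalyticAt ℝ (fun y j => eval y (P j)) x :=
  AnalyticAt.pi fun j => analyticAt_eval (P j) x

theorem fderiv_evalTuple (x v : σ → ℝ) (j : Fin c) :
    fderiv ℝ (fun y j => eval y (P j)) x v j = polyDifferential (P j) x v := by
  have := hasFDerivAt_pi.2 fun j => hasFDerivAt_eval (P j) x
  rw [this.fderiv]
  rfl

theorem fderiv_evalTuple_eq_zero {x v : σ → ℝ} :
    fderiv ℝ (fun y j => eval y (P j)) x v = 0 ↔ ∀ j, polyDifferential (P j) x v = 0 := by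
  simp [funext_iff, fderiv_evalTuple]

/-- With `J` the Jacobian matrix, `J Jᵀ μ = 0` gives `|Jᵀ μ|² = 0`, hence `Jᵀ μ = 0`, and the rows
of `J` are independent. This is the transversality hypothesis of `exists_analyticAt_normalSolution`.
-/
theorem eq_zero_of_fderiv_gradientCombination {x : σ → ℝ}
    (hli : LinearIndependent ℝ fun j => polyDifferential (P j) x) (μ : Fin c → ℝ)
    (hμ : fderiv ℝ (fun y j => eval y (P j)) x (gradientCombination P x μ) = 0) : μ = 0 := by
  rw [fderiv_evalTuple_eq_zero] at hμ
  have h0 : gradientCombination P x μ = 0 := by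
    rw [← dotProduct_self_eq_zero, dotProduct_gradientCombination]
    simp [hμ]
  have := Fintype.linearIndependent_iff.1 hli μ (by
    ext1 v
    have := dotProduct_gradientCombination P x v μ
    rw [h0, dotProduct_zero] at this
    simpa using this.symm)
  exact funext this

end Polynomials

/-! ### Local retractions and normal sections -/

section Local

variable {σ : Type*} [Fintype σ] {X : Set (σ → ℝ)} {x₀ : σ → ℝ}

/-- The vector `v` is normal to `X` at `y`. -/
def IsNormalTo (X : Set (σ → ℝ)) (y v : σ → ℝ) : Prop :=
  ∀ w ∈ varietyTangentSpace X y, w ⬝ᵥ v = 0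

theorem IsNormalTo.neg {y v : σ → ℝ} (h : IsNormalTo X y v) : IsNormalTo X y (-v) :=
  fun w hw => by rw [dotProduct_neg, h w hw, neg_zero]

theorem isNormalTo_zero (y : σ → ℝ) : IsNormalTo X y 0 := fun _ _ => dotProduct_zero _

theorem mem_varietyTangentSpace {y v : σ → ℝ} :
    v ∈ varietyTangentSpace X y ↔ ∀ p ∈ vanishingIdeal ℝ X, polyDifferential p y v = 0 := by
  simp [varietyTangentSpace]

/-- In finite dimension, a linear form that vanishes on the common kernel of finitely many forms
lies in their span; here it is the form `v ⬝ᵥ ·`. -/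
theorem isNormalTo_iff_exists_gradientCombination {c : ℕ} {P : Fin c → MvPolynomial σ ℝ}
    {y : σ → ℝ}
    (hT : ∀ v, v ∈ varietyTangentSpace X y ↔ ∀ j, polyDifferential (P j) y v = 0) (v : σ → ℝ) :
    IsNormalTo X y v ↔ ∃ μ, v = gradientCombination P y μ := by
  classical
  constructor
  · intro h
    have hmem : (dotProductBilin ℝ ℝ v : (σ → ℝ) →ₗ[ℝ] ℝ) ∈
        Submodule.span ℝ (Set.range fun j => polyDifferential (P j) y) := by
      apply mem_span_of_iInf_ker_le_ker
      intro w hw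
      simp only [Submodule.mem_iInf, LinearMap.mem_ker] at hw
      exact (dotProduct_comm v w).trans (h w ((hT w).2 hw))
    obtain ⟨μ, hμ⟩ := Submodule.mem_span_range_iff_exists_fun ℝ |>.1 hmem
    refine ⟨μ, funext fun i => ?_⟩
    have h1 := congrArg (fun L : (σ → ℝ) →ₗ[ℝ] ℝ => L (Pi.single i 1)) hμ
    have h2 := dotProduct_gradientCombination P y (Pi.single i 1) μ
    simp at h1 h2
    rw [h2, h1]
  · rintro ⟨μ, rfl⟩ w hw
    rw [dotProduct_gradientCombination]
    simp [(hT w).1 hw]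

/-- Near a nonsingular point the set `X` has an analytic retraction along its normal spaces, and
its tangent spaces are cut out by the differentials of finitely many polynomials. -/
theorem IsNonsingularAt.exists_retraction (hx₀ : x₀ ∈ X) (hX : IsNonsingularAt X x₀) :
    ∃ (c : ℕ) (P : Fin c → MvPolynomial σ ℝ),
      (∀ᶠ y in 𝓝 x₀, y ∈ X ↔ ∀ j, eval y (P j) = 0) ∧
      LinearIndependent ℝ (fun j => polyDifferential (P j) x₀) ∧
      (∀ᶠ y in 𝓝 x₀, y ∈ X →
        ∀ v, v ∈ varietyTangentSpace X y ↔ ∀ j, polyDifferential (P j) y v = 0) ∧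
      ∃ φ : (σ → ℝ) → (σ → ℝ), AnalyticAt ℝ φ x₀ ∧ φ x₀ = x₀ ∧
        (∀ᶠ z in 𝓝 x₀, φ z ∈ X ∧ IsNormalTo X (φ z) (z - φ z) ∧
          LinearMap.range (fderiv ℝ φ z : (σ → ℝ) →ₗ[ℝ] (σ → ℝ)) =
            varietyTangentSpace X (φ z)) ∧
        ∀ᶠ p : (σ → ℝ) × (σ → ℝ) in 𝓝 (x₀, x₀), p.2 ∈ X →
          IsNormalTo X p.2 (p.1 - p.2) → p.2 = φ p.1 := by
  obtain ⟨c, P, W, hPX, hWo, hxW, hXW, hli⟩ := hX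
  have hloc : ∀ᶠ y in 𝓝 x₀, y ∈ X ↔ ∀ j, eval y (P j) = 0 := by
    filter_upwards [hWo.mem_nhds hxW] with y hy
    have := Set.ext_iff.1 hXW y
    simpa [hy] using this
  have hPx₀ : ∀ j, eval x₀ (P j) = 0 := hloc.self_of_nhds.1 hx₀
  -- The normal directions are those at the unknown point itself, so the parameter is a dummy and is
  -- frozen at `x₀`.
  obtain ⟨φ, hφa, hφx, hφ, huniq⟩ := exists_analyticAt_normalSolution (w₀ := x₀)
    (B := fun q : (σ → ℝ) × (σ → ℝ) => gradientCombination P q.2)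
    (analyticAt_evalTuple P x₀)
    ((analyticAt_gradientCombination P x₀).fun_comp_of_eq analyticAt_snd rfl)
    (funext hPx₀) (eq_zero_of_fderiv_gradientCombination P hli)
  let g : (σ → ℝ) → (σ → ℝ) := fun z => φ (x₀, z)
  have hga : AnalyticAt ℝ g x₀ :=
    hφa.fun_comp_of_eq (analyticAt_const.prod analyticAt_id) rfl
  have hgx : g x₀ = x₀ := hφx
  have hgt : Filter.Tendsto g (𝓝 x₀) (𝓝 x₀) := by
    have := hga.continuousAt.tendsto
    rwa [hgx] at this
  have hpair : Filter.Tendsto (fun z : σ → ℝ => (x₀, z)) (𝓝 x₀) (𝓝 (x₀, x₀)) :=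
    (Continuous.prodMk_right x₀).tendsto x₀
  have hgX : ∀ᶠ z in 𝓝 x₀, g z ∈ X := by
    filter_upwards [hgt.eventually hloc, hpair.eventually hφ] with z h1 h2
    exact h1.2 (fun j => congrFun h2.1 j)
  have hsurj : ∀ᶠ z in 𝓝 x₀, ∀ v, (∀ j, polyDifferential (P j) (g z) v = 0) →
      ∃ k, fderiv ℝ g z k = v := by
    filter_upwards [hpair.eventually hφ, hpair.eventually hφa.eventually_analyticAt]
      with z h1 h2 v hv
    obtain ⟨k, hk⟩ := h1.2.2 v ((fderiv_evalTuple_eq_zero P).2 hv)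
    refine ⟨k, ?_⟩
    have d : HasFDerivAt g _ z := HasFDerivAt.comp (f := fun z : σ → ℝ => (x₀, z)) z
      h2.differentiableAt.hasFDerivAt ((hasFDerivAt_const x₀ z).prodMk (hasFDerivAt_id z))
    rw [d.fderiv]
    simpa using hk
  -- Since `g` takes values in `X` near `x₀`, each `p` vanishing on `X` has `p ∘ g = 0` there;
  -- differentiate.
  have htan : ∀ᶠ z in 𝓝 x₀, ∀ k, fderiv ℝ g z k ∈ varietyTangentSpace X (g z) := by
    filter_upwards [hgX.eventually_nhds, hga.eventually_analyticAt] with z h1 h2 k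
    rw [mem_varietyTangentSpace]
    intro p hp
    have d := HasFDerivAt.comp (f := g) z (hasFDerivAt_eval p (g z)) h2.differentiableAt.hasFDerivAt
    have d0 : HasFDerivAt ((fun x => eval x p) ∘ g) (0 : (σ → ℝ) →L[ℝ] ℝ) z := by
      refine (hasFDerivAt_const (0 : ℝ) z).congr_of_eventuallyEq ?_
      filter_upwards [h1] with y hy
      exact (mem_vanishingIdeal_iff.1 hp) _ hy
    have := congrArg (fun L : (σ → ℝ) →L[ℝ] ℝ => L k) (d.unique d0)
    simpa using this
  have hgfix : ∀ᶠ y in 𝓝 x₀, y ∈ X → g y = y := by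
    have h3 : Filter.Tendsto (fun y : σ → ℝ => (x₀, y, y)) (𝓝 x₀) (𝓝 (x₀, x₀, x₀)) := by
      have : Continuous (fun y : σ → ℝ => (x₀, y, y)) := by fun_prop
      exact this.tendsto x₀
    filter_upwards [h3.eventually huniq, hloc] with y h1 h2 hy
    exact (h1 (funext (h2.1 hy)) ⟨0, by simp⟩).symm
  -- The tangent space involves all polynomials vanishing on `X`, yet the `P j` suffice: a vector
  -- killed by their differentials is in the range of the differential of `g` at `y = g y`, and that
  -- range is tangent.
  have hT : ∀ᶠ y in 𝓝 x₀, y ∈ X →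
      ∀ v, v ∈ varietyTangentSpace X y ↔ ∀ j, polyDifferential (P j) y v = 0 := by
    filter_upwards [hgfix, hsurj, htan] with y h1 h2 h3 hy v
    refine ⟨fun hv j => mem_varietyTangentSpace.1 hv _ (hPX j), fun hv => ?_⟩
    rw [h1 hy] at h2 h3
    obtain ⟨k, rfl⟩ := h2 v hv
    exact h3 k
  refine ⟨c, P, hloc, hli, hT, g, hga, hgx, ?_, ?_⟩
  · filter_upwards [hgX, hgt.eventually hT, hsurj, htan, hpair.eventually hφ]
      with z h1 h2 h3 h4 h5
    refine ⟨h1, ?_, ?_⟩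
    · obtain ⟨μ, hμ⟩ := h5.2.1
      rw [isNormalTo_iff_exists_gradientCombination (h2 h1)]
      exact ⟨μ, sub_eq_iff_eq_add'.2 hμ⟩
    · ext v
      refine ⟨?_, fun hv => h3 v ((h2 h1 v).1 hv)⟩
      rintro ⟨k, rfl⟩
      exact h4 k
  · have h3 : Filter.Tendsto (fun p : (σ → ℝ) × (σ → ℝ) => (x₀, p)) (𝓝 (x₀, x₀))
        (𝓝 (x₀, x₀, x₀)) := (Continuous.prodMk_right x₀).tendsto _
    filter_upwards [h3.eventually huniq, (continuous_snd.tendsto (x₀, x₀)).eventually hloc,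
      (continuous_snd.tendsto (x₀, x₀)).eventually hT] with p h1 h2 h4 hp hn
    obtain ⟨μ, hμ⟩ := (isNormalTo_iff_exists_gradientCombination (h4 hp) _).1 hn
    exact h1 (funext (h2.1 hp)) ⟨μ, sub_eq_iff_eq_add'.1 hμ⟩

/-- Near a nonsingular point, the intersection of `X` with the affine space through `z` normal to
`X` at `y` is locally a point that depends analytically on `y` and `z`. -/
theorem IsNonsingularAt.exists_normalSection (hx₀ : x₀ ∈ X) (hX : IsNonsingularAt X x₀) :
    ∃ ψ : (σ → ℝ) × (σ → ℝ) → (σ → ℝ), AnalyticAt ℝ ψ (x₀, x₀) ∧ ψ (x₀, x₀) = x₀ ∧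
      (∀ᶠ q in 𝓝 (x₀, x₀), q.1 ∈ X → ψ q ∈ X ∧ IsNormalTo X q.1 (q.2 - ψ q)) ∧
      ∀ᶠ p : (σ → ℝ) × (σ → ℝ) × (σ → ℝ) in 𝓝 (x₀, x₀, x₀), p.1 ∈ X → p.2.2 ∈ X →
        IsNormalTo X p.1 (p.2.1 - p.2.2) → p.2.2 = ψ (p.1, p.2.1) := by
  obtain ⟨c, P, hloc, hli, hT, -⟩ := hX.exists_retraction hx₀
  -- Here the normal directions are those at the parameter `q.1`, no longer at the unknown point.
  obtain ⟨ψ, hψa, hψx, hψ, huniq⟩ := exists_analyticAt_normalSolution (w₀ := x₀)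
    (B := fun q : (σ → ℝ) × (σ → ℝ) => gradientCombination P q.1)
    (analyticAt_evalTuple P x₀)
    ((analyticAt_gradientCombination P x₀).fun_comp_of_eq analyticAt_fst rfl)
    (funext (hloc.self_of_nhds.1 hx₀)) (eq_zero_of_fderiv_gradientCombination P hli)
  have hψt : Filter.Tendsto ψ (𝓝 (x₀, x₀)) (𝓝 x₀) := by
    have := hψa.continuousAt.tendsto
    rwa [hψx] at this
  refine ⟨ψ, hψa, hψx, ?_, ?_⟩
  · filter_upwards [hψt.eventually hloc, hψ, (continuous_fst.tendsto (x₀, x₀)).eventually hT]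
      with q h1 h2 h3 hq
    refine ⟨h1.2 fun j => congrFun h2.1 j, ?_⟩
    obtain ⟨μ, hμ⟩ := h2.2.1
    rw [isNormalTo_iff_exists_gradientCombination (h3 hq)]
    exact ⟨μ, sub_eq_iff_eq_add'.2 hμ⟩
  · have h5 : Filter.Tendsto (fun p : (σ → ℝ) × (σ → ℝ) × (σ → ℝ) => p.2.2) (𝓝 (x₀, x₀, x₀))
        (𝓝 x₀) := (continuous_snd.comp continuous_snd).tendsto (x₀, x₀, x₀)
    filter_upwards [huniq, h5.eventually hloc, (continuous_fst.tendsto (x₀, x₀, x₀)).eventually hT]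
      with p h1 h2 h4 hp1 hp2 hn
    obtain ⟨μ, hμ⟩ := (isNormalTo_iff_exists_gradientCombination (h4 hp1) _).1 hn
    exact h1 (funext (h2.1 hp2)) ⟨μ, sub_eq_iff_eq_add'.1 hμ⟩

end Local

/-! ### Semialgebraic sets -/

section Semialgebraic

variable {σ τ : Type*}

theorem isSemialgebraic_empty : IsSemialgebraic (∅ : Set (σ → ℝ)) := by
  simpa using IsSemialgebraic.pos (0 : MvPolynomial σ ℝ)

theorem IsSemialgebraic.biUnion_finset {ι : Type*} (s : Finset ι) {A : ι → Set (σ → ℝ)}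
    (hA : ∀ i ∈ s, IsSemialgebraic (A i)) : IsSemialgebraic (⋃ i ∈ s, A i) := by
  classical
  induction s using Finset.induction_on with
  | empty => simpa using isSemialgebraic_empty
  | insert a s _ ih =>
    rw [Finset.set_biUnion_insert]
    exact (hA a (by simp)).union (ih fun i hi => hA i (by simp [hi]))

theorem IsSemialgebraic.biInter_finset {ι : Type*} (s : Finset ι) {A : ι → Set (σ → ℝ)}
    (hA : ∀ i ∈ s, IsSemialgebraic (A i)) : IsSemialgebraic (⋂ i ∈ s, A i) := by
  have := (IsSemialgebraic.biUnion_finset s fun i hi => (hA i hi).compl).compl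
  simpa using this

theorem IsSemialgebraic.iInter {ι : Type*} [Fintype ι] {A : ι → Set (σ → ℝ)}
    (hA : ∀ i, IsSemialgebraic (A i)) : IsSemialgebraic (⋂ i, A i) := by
  simpa using IsSemialgebraic.biInter_finset Finset.univ fun i _ => hA i

theorem isSemialgebraic_eval_eq_zero (p : MvPolynomial σ ℝ) :
    IsSemialgebraic {x | eval x p = 0} := by
  convert! ((IsSemialgebraic.pos p).union (IsSemialgebraic.pos (-p))).compl using 1
  ext x
  simp only [Set.mem_ofPred_eq, map_neg, Set.mem_compl_iff, Set.mem_union, not_or, not_lt]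
  constructor
  · intro h; simp [h]
  · rintro ⟨h1, h2⟩; linarith

/-- By Hilbert's basis theorem finitely many equations suffice. -/
theorem IsRealAlgebraicSet.isSemialgebraic [Finite σ] {X : Set (σ → ℝ)}
    (hX : IsRealAlgebraicSet X) : IsSemialgebraic X := by
  obtain ⟨I, rfl⟩ := hX
  obtain ⟨s, rfl⟩ := (isNoetherianRing_iff_ideal_fg _).1 inferInstance I
  convert! IsSemialgebraic.biInter_finset s fun p _ => isSemialgebraic_eval_eq_zero p using 1
  ext x
  simp [zeroLocus_span, aeval_eq_eval]

/-- The preimage of a semialgebraic set under a polynomial map is semialgebraic. -/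
theorem IsSemialgebraic.preimage_eval {A : Set (σ → ℝ)} (hA : IsSemialgebraic A)
    (F : σ → MvPolynomial τ ℝ) : IsSemialgebraic {y : τ → ℝ | (fun i => eval y (F i)) ∈ A} := by
  induction hA with
  | pos p =>
    convert! IsSemialgebraic.pos (bind₁ F p) using 1
    ext y
    have : eval y (bind₁ F p) = eval (fun i => eval y (F i)) p := by
      rw [← coe_aeval_eq_eval, RingHom.coe_coe, aeval_bind₁]
      rfl
    simp [this]
  | union _ _ h1 h2 => exact h1.union h2
  | inter _ _ h1 h2 => exact h1.inter h2
  | compl _ h => exact h.compl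

theorem IsSemialgebraic.preimage_comp {A : Set (σ → ℝ)} (hA : IsSemialgebraic A) (g : σ → τ) :
    IsSemialgebraic {y : τ → ℝ | y ∘ g ∈ A} := by
  convert! hA.preimage_eval fun i => (X (g i) : MvPolynomial τ ℝ) using 1
  ext y
  simp [Function.comp_def]

/-- Balls are taken in the sup norm, so they are open cubes, given by linear inequalities. -/
theorem isSemialgebraic_ball [Fintype σ] (c : σ → ℝ) {δ : ℝ} (hδ : 0 < δ) :
    IsSemialgebraic (Metric.ball c δ) := by
  convert! IsSemialgebraic.iInter fun i : σ =>
    (IsSemialgebraic.pos (C δ - (X i - C (c i)))).inter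
      (IsSemialgebraic.pos (C δ + (X i - C (c i)))) using 1
  ext x
  simp only [Metric.mem_ball, dist_pi_lt_iff hδ, Real.dist_eq, abs_lt, Set.mem_iInter,
    Set.mem_inter_iff, Set.mem_ofPred_eq, map_sub, map_add, eval_C, eval_X]
  exact forall_congr' fun i => ⟨fun h => ⟨by linarith, by linarith⟩,
    fun h => ⟨by linarith, by linarith⟩⟩

theorem IsSemialgebraic.coordProd {A : Set (σ → ℝ)} {B : Set (τ → ℝ)} (hA : IsSemialgebraic A)
    (hB : IsSemialgebraic B) : IsSemialgebraic (coordProd A B) :=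
  (hA.preimage_comp Sum.inl).inter (hB.preimage_comp Sum.inr)

end Semialgebraic

/-! ### Semialgebraicity of the normal bundle -/

section NormalBundle

open Matrix

variable {σ : Type*} [Fintype σ] {X : Set (σ → ℝ)} {x₀ : σ → ℝ}

/-- Near a nonsingular point the normal vectors are described by polynomial equations. -/
theorem IsNonsingularAt.exists_matrix_isNormalTo_iff (hx₀ : x₀ ∈ X) (hX : IsNonsingularAt X x₀) :
    ∃ H : Matrix σ σ (MvPolynomial σ ℝ), ∀ᶠ y in 𝓝 x₀, y ∈ X →
      ∀ v, IsNormalTo X y v ↔ H.map (eval y) *ᵥ v = 0 := by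
  classical
  obtain ⟨c, P, -, hli, hT, -⟩ := hX.exists_retraction hx₀
  let A : Matrix (Fin c) σ (MvPolynomial σ ℝ) := Matrix.of fun j i => pderiv i (P j)
  let G : Matrix (Fin c) (Fin c) (MvPolynomial σ ℝ) := A * Aᵀ
  have hgrad : ∀ y μ, gradientCombination P y μ = (A.map (eval y))ᵀ *ᵥ μ := by
    intro y μ
    ext i
    rw [gradientCombination_apply]
    exact Finset.sum_congr rfl fun j _ => mul_comm _ _
  have hGm : ∀ y, G.map (eval y) = A.map (eval y) * (A.map (eval y))ᵀ := fun y => by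
    rw [Matrix.map_mul, Matrix.transpose_map]
  have hdet : ∀ y, (G.map (eval y)).det = eval y G.det := fun y =>
    ((eval y).map_det G).symm
  have hdet0 : eval x₀ G.det ≠ 0 := by
    rw [← hdet]
    intro h0
    obtain ⟨μ, hμ0, hμ⟩ := Matrix.exists_mulVec_eq_zero_iff.2 h0
    refine hμ0 (eq_zero_of_fderiv_gradientCombination P hli μ ?_)
    rw [hGm, ← Matrix.mulVec_mulVec, ← hgrad] at hμ
    ext j
    rw [fderiv_evalTuple, polyDifferential_apply]
    exact congrFun hμ j
  have hnear : ∀ᶠ y in 𝓝 x₀, eval y G.det ≠ 0 :=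
    (analyticAt_eval G.det x₀).continuousAt.eventually_ne hdet0
  -- For the Jacobian `A`, the matrix `1 - Aᵀ (A Aᵀ)⁻¹ A` is the orthogonal projection onto the
  -- tangent space, and its kernel is the normal space. Multiplying by the Gram determinant, nonzero
  -- near `x₀`, clears denominators and leaves polynomial entries.
  refine ⟨G.det • 1 - Aᵀ * (G.adjugate * A), ?_⟩
  filter_upwards [hnear, hT] with y hd hTy hy v
  rw [isNormalTo_iff_exists_gradientCombination (hTy hy)]
  set a := A.map (eval y) with ha
  set d := eval y G.det with hd'
  have hH : ∀ v, (G.det • (1 : Matrix σ σ (MvPolynomial σ ℝ)) - Aᵀ * (G.adjugate * A)).map (eval y)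
      *ᵥ v = d • v - aᵀ *ᵥ ((a * aᵀ).adjugate *ᵥ (a *ᵥ v)) := by
    intro v
    have hadj : G.adjugate.map (eval y) = (a * aᵀ).adjugate := by
      rw [← hGm]; exact (eval y).map_adjugate G
    have h1 : (G.det • (1 : Matrix σ σ (MvPolynomial σ ℝ)) - Aᵀ * (G.adjugate * A)).map (eval y)
        = d • (1 : Matrix σ σ ℝ) - aᵀ * ((a * aᵀ).adjugate * a) := by
      ext i j
      rw [← hadj, ha, ← Matrix.transpose_map, ← Matrix.map_mul, ← Matrix.map_mul]
      simp only [Matrix.map_apply, Matrix.sub_apply, Matrix.smul_apply, smul_eq_mul, map_sub,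
        map_mul, Matrix.one_apply, apply_ite (eval y), map_one, map_zero, d]
    rw [h1, Matrix.sub_mulVec, Matrix.smul_mulVec, Matrix.one_mulVec, Matrix.mulVec_mulVec,
      Matrix.mulVec_mulVec, Matrix.mul_assoc]
  rw [hH, sub_eq_zero]
  constructor
  · rintro ⟨μ, rfl⟩
    rw [hgrad, ← ha, Matrix.mulVec_mulVec _ a, Matrix.mulVec_mulVec _ (a * aᵀ).adjugate,
      Matrix.adjugate_mul, ← hGm, hdet, ← hd', Matrix.smul_mulVec, Matrix.one_mulVec,
      Matrix.mulVec_smul]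
  · intro h
    refine ⟨d⁻¹ • ((a * aᵀ).adjugate *ᵥ (a *ᵥ v)), ?_⟩
    rw [hgrad, ← ha, Matrix.mulVec_smul, ← h, smul_smul, inv_mul_cancel₀ hd, one_smul]

/-- The normal bundle of a compact nonsingular variety is semialgebraic. -/
theorem IsNonsingularVariety.isSemialgebraic_normalBundle (hX : IsNonsingularVariety X)
    (hc : IsCompact X) :
    IsSemialgebraic {z : σ ⊕ σ → ℝ | z ∘ Sum.inl ∈ X ∧
      IsNormalTo X (z ∘ Sum.inl) (z ∘ Sum.inr)} := by
  have hloc : ∀ x ∈ X, ∃ (H : Matrix σ σ (MvPolynomial σ ℝ)) (ρ : ℝ), 0 < ρ ∧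
      ∀ y ∈ Metric.ball x ρ, y ∈ X → ∀ v, IsNormalTo X y v ↔ H.map (eval y) *ᵥ v = 0 := by
    intro x hx
    obtain ⟨H, hH⟩ := (hX.nonsingular x hx).exists_matrix_isNormalTo_iff hx
    obtain ⟨ρ, hρ, hb⟩ := Metric.eventually_nhds_iff_ball.1 hH
    exact ⟨H, ρ, hρ, hb⟩
  choose! H ρ hρ hH using hloc
  obtain ⟨s, hsX, hs⟩ := hc.elim_nhds_subcover (fun x => Metric.ball x (ρ x))
    fun x hx => Metric.ball_mem_nhds x (hρ x hx)
  have hpoly (x : σ → ℝ) : IsSemialgebraic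
      {z : σ ⊕ σ → ℝ | (H x).map (eval (z ∘ Sum.inl)) *ᵥ (z ∘ Sum.inr) = 0} := by
    convert! IsSemialgebraic.iInter fun i : σ => isSemialgebraic_eval_eq_zero
      (∑ j, rename Sum.inl (H x i j) * MvPolynomial.X (Sum.inr j) :
        MvPolynomial (σ ⊕ σ) ℝ) using 1
    ext z
    simp [funext_iff, Matrix.mulVec, dotProduct, eval_rename]
  convert! IsSemialgebraic.biUnion_finset s fun x hx =>
    (((hX.algebraic.isSemialgebraic.inter (isSemialgebraic_ball x (hρ x (hsX x hx)))).preimage_comp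
      Sum.inl).inter (hpoly x)) using 1
  ext z
  simp only [Set.mem_ofPred_eq, Set.mem_iUnion, Set.mem_inter_iff]
  constructor
  · rintro ⟨h1, h2⟩
    obtain ⟨x, hx, hzx⟩ := Set.mem_iUnion₂.1 (hs h1)
    exact ⟨x, hx, ⟨h1, hzx⟩, (hH x (hsX x hx) _ hzx h1 _).1 h2⟩
  · rintro ⟨x, hx, ⟨h1, hzx⟩, h2⟩
    exact ⟨h1, (hH x (hsX x hx) _ hzx h1 _).2 h2⟩

end NormalBundle

/-! ### Uniform statements by compactness -/

section Global

variable {σ : Type*} [Fintype σ] {X : Set (σ → ℝ)}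

/-- For small `t`, every point of `X` has at most one nearby point `y` of `X` such that `x + t - y`
is normal to `X` at `y`. -/
theorem IsNonsingularVariety.eventually_unique_foot (hX : IsNonsingularVariety X)
    (hc : IsCompact X) :
    ∀ᶠ q : (σ → ℝ) × (σ → ℝ) × (σ → ℝ) in 𝓝 0, ∀ x ∈ X, x + q.2.1 ∈ X → x + q.2.2 ∈ X →
      IsNormalTo X (x + q.2.1) (x + q.1 - (x + q.2.1)) →
      IsNormalTo X (x + q.2.2) (x + q.1 - (x + q.2.2)) → x + q.2.1 = x + q.2.2 := by
  -- With points written as displacements from `x`, the condition on `q` is near the fixed point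
  -- `0`, and compactness reduces uniformity in `x` to a neighbourhood of each `(0, x₀)`.
  refine hc.eventually_forall_of_forall_eventually fun x₀ hx₀ => ?_
  obtain ⟨c, P, -, -, -, φ, -, -, -, hφ⟩ := (hX.nonsingular x₀ hx₀).exists_retraction hx₀
  have h1 : Filter.Tendsto (fun z : ((σ → ℝ) × (σ → ℝ) × (σ → ℝ)) × (σ → ℝ) =>
      (z.2 + z.1.1, z.2 + z.1.2.1)) (𝓝 (0, x₀)) (𝓝 (x₀, x₀)) := by
    have : Continuous (fun z : ((σ → ℝ) × (σ → ℝ) × (σ → ℝ)) × (σ → ℝ) =>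
      (z.2 + z.1.1, z.2 + z.1.2.1)) := by fun_prop
    simpa using this.tendsto (0, x₀)
  have h2 : Filter.Tendsto (fun z : ((σ → ℝ) × (σ → ℝ) × (σ → ℝ)) × (σ → ℝ) =>
      (z.2 + z.1.1, z.2 + z.1.2.2)) (𝓝 (0, x₀)) (𝓝 (x₀, x₀)) := by
    have : Continuous (fun z : ((σ → ℝ) × (σ → ℝ) × (σ → ℝ)) × (σ → ℝ) =>
      (z.2 + z.1.1, z.2 + z.1.2.2)) := by fun_prop
    simpa using this.tendsto (0, x₀)
  filter_upwards [h1.eventually hφ, h2.eventually hφ] with z e1 e2 m1 m2 n1 n2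
  exact (e1 m1 n1).trans (e2 m2 n2).symm

/-- For small `t`, every point `y` of `X` has at most one nearby point `x` of `X` such that
`x + t - y` is normal to `X` at `y`. -/
theorem IsNonsingularVariety.eventually_unique_source (hX : IsNonsingularVariety X)
    (hc : IsCompact X) :
    ∀ᶠ q : (σ → ℝ) × (σ → ℝ) × (σ → ℝ) in 𝓝 0, ∀ y ∈ X, y + q.2.1 ∈ X → y + q.2.2 ∈ X →
      IsNormalTo X y (y + q.2.1 + q.1 - y) → IsNormalTo X y (y + q.2.2 + q.1 - y) →
      y + q.2.1 = y + q.2.2 := by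
  -- The repeated hypothesis `y ∈ X` survives the passage to a full neighbourhood of `x₀` in the
  -- ambient space; uniqueness of the normal section needs it.
  suffices h : ∀ᶠ q : (σ → ℝ) × (σ → ℝ) × (σ → ℝ) in 𝓝 0, ∀ y ∈ X, y ∈ X → y + q.2.1 ∈ X →
      y + q.2.2 ∈ X → IsNormalTo X y (y + q.2.1 + q.1 - y) →
      IsNormalTo X y (y + q.2.2 + q.1 - y) → y + q.2.1 = y + q.2.2 from
    h.mono fun q hq y hy => hq y hy hy
  refine hc.eventually_forall_of_forall_eventually fun x₀ hx₀ => ?_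
  obtain ⟨ψ, -, -, -, hψ⟩ := (hX.nonsingular x₀ hx₀).exists_normalSection hx₀
  have h1 : Filter.Tendsto (fun z : ((σ → ℝ) × (σ → ℝ) × (σ → ℝ)) × (σ → ℝ) =>
      (z.2, z.2 - z.1.1, z.2 + z.1.2.1)) (𝓝 (0, x₀)) (𝓝 (x₀, x₀, x₀)) := by
    have : Continuous (fun z : ((σ → ℝ) × (σ → ℝ) × (σ → ℝ)) × (σ → ℝ) =>
      (z.2, z.2 - z.1.1, z.2 + z.1.2.1)) := by fun_prop
    simpa using this.tendsto (0, x₀)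
  have h2 : Filter.Tendsto (fun z : ((σ → ℝ) × (σ → ℝ) × (σ → ℝ)) × (σ → ℝ) =>
      (z.2, z.2 - z.1.1, z.2 + z.1.2.2)) (𝓝 (0, x₀)) (𝓝 (x₀, x₀, x₀)) := by
    have : Continuous (fun z : ((σ → ℝ) × (σ → ℝ) × (σ → ℝ)) × (σ → ℝ) =>
      (z.2, z.2 - z.1.1, z.2 + z.1.2.2)) := by fun_prop
    simpa using this.tendsto (0, x₀)
  filter_upwards [h1.eventually hψ, h2.eventually hψ] with z e1 e2 m0 m1 m2 n1 n2
  have hneg : ∀ u : σ → ℝ, z.2 - z.1.1 - (z.2 + u) = -(z.2 + u + z.1.1 - z.2) := fun u => by abel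
  exact (e1 m0 m1 (by rw [hneg]; exact n1.neg)).trans
    (e2 m0 m2 (by rw [hneg]; exact n2.neg)).symm

/-- For small `t`, the foot of the normal through `x + t` exists near every `x ∈ X`; it is given
locally by an analytic map that submerses onto `X`. -/
theorem IsNonsingularVariety.eventually_exists_foot (hX : IsNonsingularVariety X)
    (hc : IsCompact X) {ε : ℝ} (hε : 0 < ε) :
    ∀ᶠ t in 𝓝 (0 : σ → ℝ), ∀ x ∈ X, ∃ φ : (σ → ℝ) → (σ → ℝ), AnalyticAt ℝ φ (x + t) ∧
      LinearMap.range (fderiv ℝ φ (x + t) : (σ → ℝ) →ₗ[ℝ] (σ → ℝ)) =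
        varietyTangentSpace X (φ (x + t)) ∧
      ∀ᶠ q : (σ → ℝ) × (σ → ℝ) in 𝓝 (t, x), φ (q.2 + q.1) ∈ X ∧ dist (φ (q.2 + q.1)) q.2 < ε ∧
        IsNormalTo X (φ (q.2 + q.1)) (q.2 + q.1 - φ (q.2 + q.1)) := by
  refine hc.eventually_forall_of_forall_eventually fun x₀ hx₀ => ?_
  obtain ⟨c, P, -, -, -, φ, hφa, hφx, hφ, -⟩ := (hX.nonsingular x₀ hx₀).exists_retraction hx₀
  have h1 : Filter.Tendsto (fun q : (σ → ℝ) × (σ → ℝ) => q.2 + q.1) (𝓝 (0, x₀)) (𝓝 x₀) := by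
    have : Continuous (fun q : (σ → ℝ) × (σ → ℝ) => q.2 + q.1) := by fun_prop
    simpa using this.tendsto (0, x₀)
  have h2 : Filter.Tendsto (fun q : (σ → ℝ) × (σ → ℝ) => dist (φ (q.2 + q.1)) q.2)
      (𝓝 (0, x₀)) (𝓝 0) := by
    have h3 : Filter.Tendsto (fun q : (σ → ℝ) × (σ → ℝ) => φ (q.2 + q.1)) (𝓝 (0, x₀)) (𝓝 x₀) := by
      have := hφa.continuousAt.tendsto.comp h1
      rwa [hφx] at this
    simpa using h3.dist (continuous_snd.tendsto ((0 : σ → ℝ), x₀))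
  filter_upwards [h1.eventually hφa.eventually_analyticAt, h1.eventually hφ,
    (h1.eventually hφ).eventually_nhds, (h2.eventually (gt_mem_nhds hε)).eventually_nhds]
    with q e1 e2 e3 e4
  refine ⟨φ, e1, e2.2.2, ?_⟩
  filter_upwards [e3, e4] with q' e5 e6
  exact ⟨e5.1, e6, e5.2.1⟩

/-- For small `t`, near every `y ∈ X` there is a point `x ∈ X` such that `x + t` lies on the normal
at `y`; it is given locally by an analytic map. -/
theorem IsNonsingularVariety.eventually_exists_source (hX : IsNonsingularVariety X)
    (hc : IsCompact X) {ε : ℝ} (hε : 0 < ε) :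
    ∀ᶠ t in 𝓝 (0 : σ → ℝ), ∀ y ∈ X, ∃ ψ : (σ → ℝ) → (σ → ℝ), AnalyticAt ℝ ψ y ∧
      ∀ᶠ y' in 𝓝 y, y' ∈ X → ψ y' ∈ X ∧ dist y' (ψ y') < ε ∧
        IsNormalTo X y' (ψ y' + t - y') := by
  refine hc.eventually_forall_of_forall_eventually fun x₀ hx₀ => ?_
  obtain ⟨ψ, hψa, hψx, hψ, -⟩ := (hX.nonsingular x₀ hx₀).exists_normalSection hx₀
  have h1 : Filter.Tendsto (fun q : (σ → ℝ) × (σ → ℝ) => (q.2, q.2 - q.1)) (𝓝 (0, x₀))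
      (𝓝 (x₀, x₀)) := by
    have : Continuous (fun q : (σ → ℝ) × (σ → ℝ) => (q.2, q.2 - q.1)) := by fun_prop
    simpa using this.tendsto (0, x₀)
  have h2 : Filter.Tendsto (fun q : (σ → ℝ) × (σ → ℝ) => dist q.2 (ψ (q.2, q.2 - q.1)))
      (𝓝 (0, x₀)) (𝓝 0) := by
    have h3 : Filter.Tendsto (fun q : (σ → ℝ) × (σ → ℝ) => ψ (q.2, q.2 - q.1)) (𝓝 (0, x₀))
        (𝓝 x₀) := by
      have := hψa.continuousAt.tendsto.comp h1
      rwa [hψx] at this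
    simpa using (continuous_snd.tendsto ((0 : σ → ℝ), x₀)).dist h3
  filter_upwards [h1.eventually hψa.eventually_analyticAt,
    (h1.eventually hψ).eventually_nhds, (h2.eventually (gt_mem_nhds hε)).eventually_nhds]
    with q e1 e3 e4
  have hq : Filter.Tendsto (fun y' => (q.1, y')) (𝓝 q.2) (𝓝 q) :=
    (Continuous.prodMk_right q.1).tendsto q.2
  -- That `x + t - y` is normal at `y` means that `x` lies on the affine normal space at `y` shifted
  -- to pass through `y - t`.
  refine ⟨fun y => ψ (y, y - q.1),
    AnalyticAt.fun_comp (f := fun y => (y, y - q.1)) e1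
      (analyticAt_id.prod (analyticAt_id.sub analyticAt_const)), ?_⟩
  filter_upwards [hq.eventually e3, hq.eventually e4] with y' e5 e6 hy'
  refine ⟨(e5 hy').1, e6, ?_⟩
  have := (e5 hy').2.neg
  convert this using 1
  abel

/-- The set of triples `(t, x, y)` with `y` the foot near `x` of a normal through `x + t` is
semialgebraic. -/
theorem IsNonsingularVariety.isSemialgebraic_foot (hX : IsNonsingularVariety X)
    (hc : IsCompact X) {U : Set (σ → ℝ)} (hU : IsSemialgebraic U) {ε : ℝ} (hε : 0 < ε) :
    IsSemialgebraic {z : (σ ⊕ σ) ⊕ σ → ℝ | z ∘ Sum.inl ∈ coordProd U X ∧ z ∘ Sum.inr ∈ X ∧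
      dist (z ∘ Sum.inr) (z ∘ Sum.inl ∘ Sum.inr) < ε ∧
      IsNormalTo X (z ∘ Sum.inr) (z ∘ Sum.inl ∘ Sum.inr + z ∘ Sum.inl ∘ Sum.inl - z ∘ Sum.inr)} := by
  have h1 := (hU.coordProd hX.algebraic.isSemialgebraic).preimage_comp
    (Sum.inl : σ ⊕ σ → (σ ⊕ σ) ⊕ σ)
  have h2 := (isSemialgebraic_ball (0 : σ → ℝ) hε).preimage_eval
    (fun i : σ => (.X (.inr i) - .X (.inl (.inr i)) : MvPolynomial ((σ ⊕ σ) ⊕ σ) ℝ))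
  have h3 := (hX.isSemialgebraic_normalBundle hc).preimage_eval (Sum.elim
    (fun i : σ => (.X (.inr i) : MvPolynomial ((σ ⊕ σ) ⊕ σ) ℝ))
    (fun i : σ => .X (.inl (.inr i)) + .X (.inl (.inl i)) - .X (.inr i)))
  convert! h1.inter (h2.inter h3) using 1
  ext z
  have e2 : (fun i : σ => eval z (.X (.inr i) - .X (.inl (.inr i)) : MvPolynomial ((σ ⊕ σ) ⊕ σ) ℝ))
      = z ∘ Sum.inr - z ∘ Sum.inl ∘ Sum.inr := by
    ext i; simp
  simp only [Set.mem_ofPred_eq, Set.mem_inter_iff, e2, mem_ball_zero_iff, ← dist_eq_norm]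
  have e3 : (fun i => eval z (Sum.elim (fun i : σ => (.X (.inr i) : MvPolynomial ((σ ⊕ σ) ⊕ σ) ℝ))
    (fun i : σ => .X (.inl (.inr i)) + .X (.inl (.inl i)) - .X (.inr i)) i)) =
      Sum.elim (z ∘ Sum.inr)
        (z ∘ Sum.inl ∘ Sum.inr + z ∘ Sum.inl ∘ Sum.inl - z ∘ Sum.inr) := by
    ext i; cases i <;> simp
  rw [e3, Sum.elim_comp_inl, Sum.elim_comp_inr]
  tauto

end Global

/-! ### Construction of the deformation -/

theorem mainTheorem10 (r : ℕ) (X : Set (Fin r → ℝ)) (hX : IsNonsingularVariety X)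
    (hcompact : IsCompact X) :
    ∃ (l : ℕ) (U : Set (Fin l → ℝ)) (Θ : (Fin l → ℝ) → (Fin r → ℝ) → (Fin r → ℝ)),
      IsSubmersiveNashDeformation X U Θ := by
  -- The order matters: `ε` is the radius within which feet and sources are unique, and `δ'` is then
  -- chosen so that they exist within that same `ε`. Uniqueness also needs `‖t‖ < ε`, hence the
  -- minimum in `δ`.
  obtain ⟨ε, hε, hball⟩ := Metric.eventually_nhds_iff_ball.1
    ((hX.eventually_unique_foot hcompact).and (hX.eventually_unique_source hcompact))
  obtain ⟨δ', hδ', hballδ⟩ := Metric.eventually_nhds_iff_ball.1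
    ((hX.eventually_exists_foot hcompact hε).and (hX.eventually_exists_source hcompact hε))
  let δ := min δ' ε
  have hδ : 0 < δ := lt_min hδ' hε
  let U : Set (Fin r → ℝ) := Metric.ball 0 δ
  -- `R t x y`: the point `y` is the foot near `x` of a normal through `x + t`
  let R (t x y : Fin r → ℝ) : Prop := dist y x < ε ∧ IsNormalTo X y (x + t - y)
  have hmem : ∀ {t u u' : Fin r → ℝ}, t ∈ U → ‖u‖ < ε → ‖u'‖ < ε →
      (t, u, u') ∈ Metric.ball (0 : (Fin r → ℝ) × (Fin r → ℝ) × (Fin r → ℝ)) ε := by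
    intro t u u' ht hu hu'
    have ht' : ‖t‖ < ε := (mem_ball_zero_iff.1 ht).trans_le (min_le_right _ _)
    rw [mem_ball_zero_iff, Prod.norm_def, Prod.norm_def]
    exact max_lt ht' (max_lt hu hu')
  have huniq : ∀ t ∈ U, ∀ x ∈ X, ∀ y ∈ X, ∀ y' ∈ X, R t x y → R t x y' → y = y' := by
    intro t ht x hx y hy y' hy' h h'
    have := (hball _ (hmem (u := y - x) (u' := y' - x) ht
      (by rw [← dist_eq_norm]; exact h.1) (by rw [← dist_eq_norm]; exact h'.1))).1 x hx
    simp only [add_sub_cancel] at this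
    exact this hy hy' h.2 h'.2
  have huniq' : ∀ t ∈ U, ∀ y ∈ X, ∀ x ∈ X, ∀ x' ∈ X, R t x y → R t x' y → x = x' := by
    intro t ht y hy x hx x' hx' h h'
    have := (hball _ (hmem (u := x - y) (u' := x' - y) ht
      (by rw [← dist_eq_norm, dist_comm]; exact h.1)
      (by rw [← dist_eq_norm, dist_comm]; exact h'.1))).2 y hy
    simp only [add_sub_cancel] at this
    exact this hx hx' h.2 h'.2
  have hUδ : U ⊆ Metric.ball 0 δ' := Metric.ball_subset_ball (min_le_left _ _)
  -- Both maps are choices from the same relation `R`, read in its two directions. Existence and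
  -- uniqueness make them well determined for `t ∈ U` on `X`; other values are irrelevant.
  let Θ (t x : Fin r → ℝ) : Fin r → ℝ := Classical.epsilon fun y => y ∈ X ∧ R t x y
  let Ψ (t y : Fin r → ℝ) : Fin r → ℝ := Classical.epsilon fun x => x ∈ X ∧ R t x y
  have hΘ : ∀ t ∈ U, ∀ x ∈ X, Θ t x ∈ X ∧ R t x (Θ t x) := by
    intro t ht x hx
    obtain ⟨φ, -, -, hφ⟩ := (hballδ t (hUδ ht)).1 x hx
    exact Classical.epsilon_spec (p := fun y => y ∈ X ∧ R t x y) ⟨_, hφ.self_of_nhds⟩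
  have hΨ : ∀ t ∈ U, ∀ y ∈ X, Ψ t y ∈ X ∧ R t (Ψ t y) y := by
    intro t ht y hy
    obtain ⟨ψ, -, hψ⟩ := (hballδ t (hUδ ht)).2 y hy
    exact Classical.epsilon_spec (p := fun x => x ∈ X ∧ R t x y) ⟨_, hψ.self_of_nhds hy⟩
  have hΘ_iff : ∀ t ∈ U, ∀ x ∈ X, ∀ y, y = Θ t x ↔ y ∈ X ∧ R t x y := by
    intro t ht x hx y
    refine ⟨fun h => h ▸ hΘ t ht x hx, fun h => ?_⟩
    exact huniq t ht x hx y h.1 _ (hΘ t ht x hx).1 h.2 (hΘ t ht x hx).2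
  have hUopen : IsOpen U := Metric.isOpen_ball
  have hUsemi : IsSemialgebraic U := isSemialgebraic_ball 0 hδ
  -- local analytic description of `Θ`
  have hΘ_loc : ∀ t ∈ U, ∀ x ∈ X, ∃ φ : (Fin r → ℝ) → (Fin r → ℝ), AnalyticAt ℝ φ (x + t) ∧
      LinearMap.range (fderiv ℝ φ (x + t) : (Fin r → ℝ) →ₗ[ℝ] (Fin r → ℝ)) =
        varietyTangentSpace X (φ (x + t)) ∧
      ∀ᶠ q : (Fin r → ℝ) × (Fin r → ℝ) in 𝓝 (t, x),
        q.2 ∈ X → Θ q.1 q.2 = φ (q.2 + q.1) := by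
    intro t ht x hx
    obtain ⟨φ, hφa, hφr, hφ⟩ := (hballδ t (hUδ ht)).1 x hx
    refine ⟨φ, hφa, hφr, ?_⟩
    filter_upwards [hφ, (continuous_fst.tendsto (t, x)).eventually (hUopen.mem_nhds ht)]
      with q h1 h2 h3
    exact ((hΘ_iff q.1 h2 q.2 h3 _).2 h1).symm
  have hnash : IsNashMap (coordProd U X) X (fun z => Θ (z ∘ Sum.inl) (z ∘ Sum.inr)) := by
    refine ⟨fun z hz => (hΘ _ hz.1 _ hz.2).1, fun z hz => ?_, ?_⟩
    · obtain ⟨φ, hφa, -, hφ⟩ := hΘ_loc _ hz.1 _ hz.2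
      have hcont : Filter.Tendsto (fun z : Fin r ⊕ Fin r → ℝ => (z ∘ Sum.inl, z ∘ Sum.inr)) (𝓝 z)
          (𝓝 (z ∘ Sum.inl, z ∘ Sum.inr)) := by
        have : Continuous (fun z : Fin r ⊕ Fin r → ℝ => (z ∘ Sum.inl, z ∘ Sum.inr)) := by
          fun_prop
        exact this.tendsto z
      have hadd : AnalyticAt ℝ (fun z : Fin r ⊕ Fin r → ℝ => z ∘ Sum.inr + z ∘ Sum.inl) z :=
        (((LinearMap.funLeft ℝ ℝ (Sum.inr : Fin r → Fin r ⊕ Fin r)) +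
          (LinearMap.funLeft ℝ ℝ (Sum.inl : Fin r → Fin r ⊕ Fin r))).toContinuousLinearMap).analyticAt
          z
      have h1 : AnalyticAt ℝ (fun z : Fin r ⊕ Fin r → ℝ => φ (z ∘ Sum.inr + z ∘ Sum.inl)) z :=
        AnalyticAt.fun_comp (g := φ) hφa hadd
      refine h1.analyticWithinAt.congr_of_eventuallyEq ?_ (hφ.self_of_nhds hz.2)
      filter_upwards [(hcont.eventually hφ).filter_mono nhdsWithin_le_nhds,
        self_mem_nhdsWithin] with z' h2 h3
      exact h2 h3.2
    · convert! hX.isSemialgebraic_foot hcompact hUsemi hε using 1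
      ext z
      simp only [graphOver, Set.mem_ofPred_eq]
      exact and_congr_right fun hz => hΘ_iff _ hz.1 _ hz.2 _
  have hΨΘ : ∀ t ∈ U, Set.InvOn (Ψ t) (Θ t) X X := by
    intro t ht
    constructor
    · intro x hx
      obtain ⟨h1, h2⟩ := hΘ t ht x hx
      obtain ⟨h3, h4⟩ := hΨ t ht _ h1
      exact huniq' t ht _ h1 _ h3 _ hx h4 h2
    · intro y hy
      obtain ⟨h1, h2⟩ := hΨ t ht y hy
      exact ((hΘ_iff t ht _ h1 y).2 ⟨hy, h2⟩).symm
  have hgraph : ∀ t ∈ U, IsSemialgebraic (graphOver X (Θ t)) := by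
    intro t ht
    -- The graph of `Θ t` is the slice of the graph of `Θ` at constant `t`, hence a preimage under a
    -- polynomial map.
    convert! hnash.semialgebraic_graph.preimage_eval (Sum.elim (Sum.elim (fun i => C (t i))
      fun i => .X (.inl i)) fun i => (.X (.inr i) : MvPolynomial (Fin r ⊕ Fin r) ℝ)) using 1
    ext z
    have e : (fun i => eval z (Sum.elim (Sum.elim (fun i => C (t i))
      fun i => .X (.inl i)) (fun i => (.X (.inr i) : MvPolynomial (Fin r ⊕ Fin r) ℝ)) i)) =
      Sum.elim (Sum.elim t (z ∘ Sum.inl)) (z ∘ Sum.inr) := by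
      ext i; rcases i with (i | i) | i <;> simp
    simp [e, graphOver, coordProd, ht]
  refine ⟨r, U, Θ, hUopen, Metric.mem_ball_self hδ, hUsemi, hnash, fun t ht => ?_,
    fun x hx => ?_, fun x hx t ht => ?_⟩
  · refine ⟨⟨fun x hx => (hΘ t ht x hx).1, fun x hx => ?_, hgraph t ht⟩, Ψ t,
      ⟨fun y hy => (hΨ t ht y hy).1, fun y hy => ?_, ?_⟩, hΨΘ t ht⟩
    · obtain ⟨φ, hφa, -, hφ⟩ := hΘ_loc t ht x hx
      have h1 : AnalyticAt ℝ (fun x => φ (x + t)) x :=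
        AnalyticAt.fun_comp (f := fun x => x + t) hφa (analyticAt_id.add analyticAt_const)
      refine h1.analyticWithinAt.congr_of_eventuallyEq ?_ (hφ.self_of_nhds hx)
      have hc : Filter.Tendsto (fun x' => (t, x')) (𝓝 x) (𝓝 (t, x)) :=
        (Continuous.prodMk_right t).tendsto x
      filter_upwards [(hc.eventually hφ).filter_mono nhdsWithin_le_nhds,
        self_mem_nhdsWithin] with x' h2 h3
      exact h2 h3
    · obtain ⟨ψ, hψa, hψ⟩ := (hballδ t (hUδ ht)).2 y hy
      have h1 : ∀ y' ∈ X, (ψ y' ∈ X ∧ dist y' (ψ y') < ε ∧ IsNormalTo X y' (ψ y' + t - y')) →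
          Ψ t y' = ψ y' := fun y' hy' h =>
        huniq' t ht y' hy' _ (hΨ t ht y' hy').1 _ h.1 (hΨ t ht y' hy').2 h.2
      refine hψa.analyticWithinAt.congr_of_eventuallyEq ?_ (h1 y hy (hψ.self_of_nhds hy))
      filter_upwards [hψ.filter_mono nhdsWithin_le_nhds, self_mem_nhdsWithin] with y' h2 h3
      exact h1 y' h3 (h2 h3)
    -- The graph of the inverse is the graph of `Θ t` with its two factors exchanged.
    · convert! (hgraph t ht).preimage_comp Sum.swap using 1
      ext z
      simp only [graphOver, Set.mem_ofPred_eq, Function.comp_assoc]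
      have e1 : (Sum.swap : Fin r ⊕ Fin r → _) ∘ Sum.inl = Sum.inr := rfl
      have e2 : (Sum.swap : Fin r ⊕ Fin r → _) ∘ Sum.inr = Sum.inl := rfl
      rw [e1, e2]
      constructor
      · rintro ⟨h1, h2⟩
        rw [h2]
        exact ⟨(hΨ t ht _ h1).1, ((hΨΘ t ht).2 h1).symm⟩
      · rintro ⟨h1, h2⟩
        rw [h2]
        exact ⟨(hΘ t ht _ h1).1, ((hΨΘ t ht).1 h1).symm⟩
  · refine ((hΘ_iff 0 (Metric.mem_ball_self hδ) x hx x).2 ⟨hx, by simpa using hε, ?_⟩).symm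
    simpa using isNormalTo_zero x
  -- Near `t` the map `s ↦ Θ s x` is `φ` after a translation, so its differential is that of `φ` at
  -- `x + t`, whose range is the tangent space.
  · obtain ⟨φ, hφa, hφr, hφ⟩ := hΘ_loc t ht x hx
    have hc : Filter.Tendsto (fun s => (s, x)) (𝓝 t) (𝓝 (t, x)) :=
      (Continuous.prodMk_left x).tendsto t
    have heq : (fun s => Θ s x) =ᶠ[𝓝 t] fun s => φ (x + s) := by
      filter_upwards [hc.eventually hφ] with s hs
      exact hs hx
    have hd : HasFDerivAt (fun s => φ (x + s)) (fderiv ℝ φ (x + t)) t := by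
      simpa using HasFDerivAt.comp (f := fun s => x + s) t hφa.differentiableAt.hasFDerivAt
        ((hasFDerivAt_id t).const_add x)
    have hd' := hd.congr_of_eventuallyEq heq
    refine ⟨hd'.differentiableAt, ?_⟩
    rw [hd'.fderiv, hφr]
    exact congrArg (varietyTangentSpace X) heq.self_of_nhds.symm
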